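/- Let $K\ge 1$ and let $N_0,N_1,\dots,N_K$ be positive integers with $N_0=\min_{0\le k\le K}N_k$. Let $Q_1,\dots,Q_K$ be random complex matrices, $Q_k$ of size $N_k\times N_{k-1}$, such that all entries of all the $Q_k$ are mutually independent, circularly symmetric complex Gaussian variables with mean zero and unit variance (density $\pi^{-1}e^{-|z|^2}$ on $\mathbb{C}$). Let $H=Q_KQ_{K-1}\cdots Q_1$, of size $N_K\times N_0$ (the Rayleigh product channel), and let $q\ge 0$. Then $\ln\det(I+qH^\dagger H)$ is integrable, and the ergodic capacity $\tilde R=\mathbb{E}\left[\ln\det(I+qH^\dagger H)\right]$ satisfies $$N_0\ln\left(1+q\exp(g-K\gamma)\right)\;\le\;\tilde R\;\le\;N_0\ln\left(1+q\prod_{k=1}^{K}N_k\right),$$ where $\gamma$ is the Euler–Mascheroni constant and $$g=\frac{1}{N_0}\sum_{k=1}^{K}\sum_{\ell=1}^{N_0}\sum_{r=1}^{N_k-\ell}\frac1r=K\gamma+\frac{1}{N_0}\sum_{k=1}^{K}\sum_{\ell=1}^{N_0}\psi(N_k-\ell+1),$$ with $\psi=\Gamma'/\Gamma$ the digamma function.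 -/

import Mathlib

open MeasureTheory ProbabilityTheory

noncomputable section

namespace RayleighProduct

/-- The law of a (circularly symmetric) complex Gaussian variable with mean zero and unit variance:
its density with respect to Lebesgue measure on `ℂ` is `exp (-|z|²) / π`. -/
def stdComplexGaussian : Measure ℂ :=
  volume.withDensity fun z => ENNReal.ofReal (Real.exp (-‖z‖ ^ 2) / Real.pi)

/-- The matrices `Q 0, …, Q (K-1)` (of sizes `N (k+1) × N k`) are independent Rayleigh channels:
all entries of all the matrices are mutually independent standard complex Gaussian variables. -/
structure IsRayleigh {Ω : Type*} [MeasurableSpace Ω] (P : Measure Ω) {K : ℕ} (N : Fin (K + 1) → ℕ)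
    (Q : (k : Fin K) → Ω → Matrix (Fin (N k.succ)) (Fin (N k.castSucc)) ℂ) : Prop where
  hasLaw : ∀ k i j, HasLaw (fun ω => Q k ω i j) stdComplexGaussian P
  indep : iIndepFun
    (fun (e : (k : Fin K) × (Fin (N k.succ) × Fin (N k.castSucc))) ω => Q e.1 ω e.2.1 e.2.2) P

/-- The partial products `Q (k-1) * ⋯ * Q 1 * Q 0`, of size `N k × N 0`. -/
def partialProduct {K : ℕ} (N : Fin (K + 1) → ℕ)
    (Q : (k : Fin K) → Matrix (Fin (N k.succ)) (Fin (N k.castSucc)) ℂ) (k : Fin (K + 1)) :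
    Matrix (Fin (N k)) (Fin (N 0)) ℂ :=
  Fin.induction (motive := fun k => Matrix (Fin (N k)) (Fin (N 0)) ℂ) 1 (fun k M => Q k * M) k

/-- The product channel `H = Q (K-1) * ⋯ * Q 1 * Q 0`, of size `N K × N 0`. -/
def productChannel {K : ℕ} (N : Fin (K + 1) → ℕ)
    (Q : (k : Fin K) → Matrix (Fin (N k.succ)) (Fin (N k.castSucc)) ℂ) :
    Matrix (Fin (N (Fin.last K))) (Fin (N 0)) ℂ :=
  partialProduct N Q (Fin.last K)

/-- The capacity `ln det (I + q H† H)` in nats per channel use. The determinant is a positive real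
number for `q ≥ 0`, so it equals its real part. -/
def capacity {m n : ℕ} (q : ℝ) (H : Matrix (Fin m) (Fin n) ℂ) : ℝ :=
  Real.log (1 + (q : ℂ) • (H.conjTranspose * H)).det.re

/-- The ergodic capacity: the expectation of the capacity of the product channel. -/
def ergodicCapacity {Ω : Type*} [MeasurableSpace Ω] (P : Measure Ω) {K : ℕ} (N : Fin (K + 1) → ℕ)
    (Q : (k : Fin K) → Ω → Matrix (Fin (N k.succ)) (Fin (N k.castSucc)) ℂ) (q : ℝ) : ℝ :=
  ∫ ω, capacity q (productChannel N fun k => Q k ω) ∂P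

/-- `g = (1 / N₀) ∑_{k=1}^K ∑_{ℓ=1}^{N₀} ∑_{r=1}^{N_k - ℓ} 1 / r`; used only when `N₀ ≤ N_k`, so that
the natural-number subtraction does not truncate. -/
def gConst {K : ℕ} (N : Fin (K + 1) → ℕ) : ℝ :=
  (1 / (N 0 : ℝ)) * ∑ k : Fin K, ∑ l ∈ Finset.Icc 1 (N 0),
    ∑ r ∈ Finset.Icc 1 (N k.succ - l), 1 / (r : ℝ)

/-- The digamma function `ψ = Γ' / Γ` on the reals. -/
def digamma (x : ℝ) : ℝ := logDeriv Real.Gamma x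

end RayleighProduct

end

noncomputable section

namespace RayleighProduct

/-! Both bounds are Jensen's inequality, applied through tangent lines to the eigenvalues `λ_i` of
`H† H`. The logarithm is concave, and its tangent at `1 + q ∏ N_k` bounds the capacity above by an
affine function of `∑ λ_i = ‖H‖_F²`, whose mean is `N_0 ∏ N_k`. The function `x ↦ ln (1 + q e^x)` is
convex, and its tangent at `c = g - K γ` bounds the capacity below by an affine function of `∑ ln
λ_i = ln det (H† H)`, whose mean is `N_0 c`. At these points the linear terms integrate to zero
(`capacity_le`, `le_capacity`). The upper tangent also dominates the nonnegative capacity, which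
gives integrability.

The work is in the mean of `ln det (H† H)`. If `A` has full column rank, then `A = U B` with `U† U =
1` and `B` square, and `det ((Q A)† Q A) = det ((Q U)† Q U) |det B|²`. By unitary invariance `Q U`
is again a Gaussian matrix, with `N_0` columns. Hence the ratio of successive Gram determinants has
a law that does not depend on the past (`map_gramDet_mul_div`), and the log-means add up over the
factors (`HasLogMean.of_indepFun`).

For one Gaussian matrix the columns are split off in the same way: the Gram determinant is the
squared norm of one column times that of the other columns projected to its orthogonal complement,
which is Gaussian with one row fewer (`map_gramDet_fromCols_div`). The squared norm of a Gaussian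
vector in `ℂ^(n+1)` has the `Γ(n+1)` law, with log-mean `ψ(n+1) = H_n - γ`.

The mean of `‖H‖_F²` is likewise multiplied by the number of rows of each new factor
(`lintegral_frobSq_mul`). -/

/-! ### Complex Gaussian measures and their unitary invariance. -/

lemma integral_exp_neg_sq_norm_div (ι : Type*) [Fintype ι] :
    ∫ x : EuclideanSpace ℂ ι, Real.exp (-‖x‖ ^ 2) / Real.pi ^ Fintype.card ι = 1 := by
  have h := GaussianFourier.integral_rexp_neg_mul_sq_norm (V := EuclideanSpace ℂ ι) one_pos
  have hd : Module.finrank ℝ (EuclideanSpace ℂ ι) = 2 * Fintype.card ι := by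
    rw [← Module.finrank_mul_finrank ℝ ℂ, finrank_euclideanSpace, Complex.finrank_real_complex]
  rw [hd] at h
  rw [integral_div]
  simp only [neg_mul, one_mul, div_one] at h
  rw [h]
  push_cast
  rw [mul_div_cancel_left₀ _ two_ne_zero, Real.rpow_natCast, div_self (by positivity)]

/-- The standard complex Gaussian law on a Euclidean space over `ℂ`. -/
def euclideanGaussian (ι : Type*) [Fintype ι] : Measure (EuclideanSpace ℂ ι) :=
  volume.withDensity fun x => ENNReal.ofReal (Real.exp (-‖x‖ ^ 2) / Real.pi ^ Fintype.card ι)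

instance (ι : Type*) [Fintype ι] : IsProbabilityMeasure (euclideanGaussian ι) := by
  constructor
  have hi : Integrable (fun x : EuclideanSpace ℂ ι =>
      Real.exp (-‖x‖ ^ 2) / Real.pi ^ Fintype.card ι) := by
    -- The integral of a non-integrable function is `0` by convention, so the value `1` forces
    -- integrability.
    by_contra h
    have := integral_exp_neg_sq_norm_div ι
    rw [integral_undef h] at this
    exact zero_ne_one this
  rw [euclideanGaussian, withDensity_apply _ .univ, Measure.restrict_univ,
    ← ofReal_integral_eq_lintegral_ofReal hi (.of_forall fun x => by positivity),
    integral_exp_neg_sq_norm_div, ENNReal.ofReal_one]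

lemma integral_euclideanGaussian {ι : Type*} [Fintype ι] {F : Type*} [NormedAddCommGroup F]
    [NormedSpace ℝ F] (f : EuclideanSpace ℂ ι → F) :
    ∫ x, f x ∂euclideanGaussian ι =
      ∫ x, (Real.exp (-‖x‖ ^ 2) / Real.pi ^ Fintype.card ι) • f x := by
  rw [euclideanGaussian, integral_withDensity_eq_integral_toReal_smul (by fun_prop) (by simp)]
  refine integral_congr_ae (.of_forall fun x => ?_)
  dsimp only
  rw [ENNReal.toReal_ofReal (by positivity)]

lemma integrable_euclideanGaussian_iff {ι : Type*} [Fintype ι] (f : EuclideanSpace ℂ ι → ℝ) :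
    Integrable f (euclideanGaussian ι) ↔
      Integrable fun x => Real.exp (-‖x‖ ^ 2) / Real.pi ^ Fintype.card ι * f x := by
  rw [euclideanGaussian, integrable_withDensity_iff_integrable_smul' (by fun_prop) (by simp)]
  refine integrable_congr (.of_forall fun x => ?_)
  dsimp only
  rw [ENNReal.toReal_ofReal (by positivity), smul_eq_mul]

/-- The factor `1/4` appears because each real coordinate has variance `1/2`. -/
lemma charFun_euclideanGaussian {ι : Type*} [Fintype ι] (t : EuclideanSpace ℂ ι) :
    charFun (euclideanGaussian ι) t = Complex.exp (-‖t‖ ^ 2 / 4) := by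
  have h := GaussianFourier.integral_cexp_neg_mul_sq_norm_add (V := EuclideanSpace ℂ ι)
    (b := 1) (by simp) Complex.I t
  have hd : Module.finrank ℝ (EuclideanSpace ℂ ι) = 2 * Fintype.card ι := by
    rw [← Module.finrank_mul_finrank ℝ ℂ, finrank_euclideanSpace, Complex.finrank_real_complex]
  rw [hd] at h
  have hpi : (Real.pi : ℂ) ^ Fintype.card ι ≠ 0 := pow_ne_zero _ (by simp [Real.pi_ne_zero])
  rw [charFun_apply, integral_euclideanGaussian]
  have he : ∀ x : EuclideanSpace ℂ ι, (Real.exp (-‖x‖ ^ 2) / Real.pi ^ Fintype.card ι) •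
      Complex.exp ((inner ℝ x t : ℝ) * Complex.I) =
      ((Real.pi : ℂ) ^ Fintype.card ι)⁻¹ *
        Complex.exp (-1 * ‖x‖ ^ 2 + Complex.I * (inner ℝ t x : ℝ)) := by
    intro x
    rw [Complex.exp_add, Complex.real_smul, real_inner_comm]
    push_cast
    rw [mul_comm Complex.I, neg_one_mul]
    field_simp
  simp_rw [he]
  rw [integral_const_mul, h]
  push_cast
  rw [mul_div_cancel_left₀ _ two_ne_zero, div_one, Complex.cpow_natCast, ← mul_assoc,
    inv_mul_cancel₀ hpi, Complex.I_sq, one_mul]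
  congr 1
  ring

lemma integral_stdComplexGaussian {F : Type*} [NormedAddCommGroup F]
    [NormedSpace ℝ F] (f : ℂ → F) :
    ∫ x, f x ∂stdComplexGaussian = ∫ x, (Real.exp (-‖x‖ ^ 2) / Real.pi) • f x := by
  rw [stdComplexGaussian, integral_withDensity_eq_integral_toReal_smul (by fun_prop) (by simp)]
  refine integral_congr_ae (.of_forall fun x => ?_)
  dsimp only
  rw [ENNReal.toReal_ofReal (by positivity)]

lemma charFun_stdComplexGaussian (t : ℂ) :
    charFun stdComplexGaussian t = Complex.exp (-‖t‖ ^ 2 / 4) := by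
  have h := GaussianFourier.integral_cexp_neg_mul_sq_norm_add (V := ℂ) (b := 1)
    (by simp) Complex.I t
  have hpi : (Real.pi : ℂ) ≠ 0 := by simp [Real.pi_ne_zero]
  rw [charFun_apply, integral_stdComplexGaussian]
  have he : ∀ x : ℂ, (Real.exp (-‖x‖ ^ 2) / Real.pi) •
      Complex.exp ((inner ℝ x t : ℝ) * Complex.I) =
      (Real.pi : ℂ)⁻¹ * Complex.exp (-1 * ‖x‖ ^ 2 + Complex.I * (inner ℝ t x : ℝ)) := by
    intro x
    rw [Complex.exp_add, Complex.real_smul, real_inner_comm]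
    push_cast
    rw [mul_comm Complex.I, neg_one_mul]
    field_simp
  simp_rw [he]
  rw [integral_const_mul, h]
  simp only [Complex.finrank_real_complex, Nat.cast_ofNat, div_one, div_self (two_ne_zero (α := ℂ)),
    Complex.cpow_one, Complex.I_sq, ← mul_assoc, inv_mul_cancel₀ hpi, one_mul]
  congr 1
  ring

instance : IsProbabilityMeasure stdComplexGaussian := by
  constructor
  have h1 : ∫ x : ℂ, Real.exp (-‖x‖ ^ 2) / Real.pi = 1 := by
    have h := GaussianFourier.integral_rexp_neg_mul_sq_norm (V := ℂ) one_pos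
    rw [integral_div]
    simp only [neg_mul, one_mul, div_one] at h
    rw [h]
    simp [Real.pi_ne_zero]
  have hi : Integrable (fun x : ℂ => Real.exp (-‖x‖ ^ 2) / Real.pi) := by
    by_contra h
    rw [integral_undef h] at h1
    exact zero_ne_one h1
  rw [stdComplexGaussian, withDensity_apply _ .univ, Measure.restrict_univ,
    ← ofReal_integral_eq_lintegral_ofReal hi (.of_forall fun x => by positivity), h1,
    ENNReal.ofReal_one]

/-- The law of a family of independent standard complex Gaussian variables. -/
def gaussianPi (ι : Type*) [Fintype ι] : Measure (ι → ℂ) :=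
  Measure.pi fun _ => stdComplexGaussian

instance (ι : Type*) [Fintype ι] : IsProbabilityMeasure (gaussianPi ι) := by
  unfold gaussianPi; infer_instance

lemma charFun_map_toLp_gaussianPi {ι : Type*} [Fintype ι] (t : EuclideanSpace ℂ ι) :
    charFun ((gaussianPi ι).map (WithLp.toLp 2)) t = Complex.exp (-‖t‖ ^ 2 / 4) := by
  rw [gaussianPi, charFun_pi]
  simp_rw [charFun_stdComplexGaussian]
  rw [← Complex.exp_sum, ← Finset.sum_div, Finset.sum_neg_distrib]
  congr 3
  rw [← Complex.ofReal_pow, EuclideanSpace.norm_sq_eq]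
  push_cast
  rfl

/-- The characteristic functions agree. The product form suits independence, while the radial
density allows polar coordinates. -/
lemma map_toLp_gaussianPi (ι : Type*) [Fintype ι] :
    (gaussianPi ι).map (WithLp.toLp 2) = euclideanGaussian ι := by
  have : IsProbabilityMeasure ((gaussianPi ι).map (WithLp.toLp 2)) :=
    Measure.isProbabilityMeasure_map (by fun_prop)
  apply Measure.ext_of_charFun
  ext t
  rw [charFun_map_toLp_gaussianPi, charFun_euclideanGaussian]

lemma euclideanSpace_real_inner_eq {ι : Type*} [Fintype ι] (x y : EuclideanSpace ℂ ι) :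
    inner ℝ x y = (∑ k, y k * star (x k)).re := by
  rw [PiLp.inner_apply, Complex.re_sum]
  exact Finset.sum_congr rfl fun k _ => by simp [Complex.inner]

/-- A map between complex coordinate spaces that is a left inverse of its adjoint sends the
standard complex Gaussian law to the standard complex Gaussian law. -/
lemma map_gaussianPi_of_adjoint {ι κ : Type*} [Fintype ι] [Fintype κ]
    {Φ : (ι → ℂ) → (κ → ℂ)} {Ψ : (κ → ℂ) → (ι → ℂ)} (hΦ : Measurable Φ)
    (hadj : ∀ x t, ∑ k, Φ x k * star (t k) = ∑ i, x i * star (Ψ t i))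
    (hinv : ∀ t, Φ (Ψ t) = t) :
    (gaussianPi ι).map Φ = gaussianPi κ := by
  -- `⟨Ψ t, Ψ t⟩ = ⟨Φ (Ψ t), t⟩ = ⟨t, t⟩`. The characteristic function of the image at `t` is that
  -- of the source at `Ψ t`, which depends only on `‖Ψ t‖ = ‖t‖`.
  have hiso : ∀ t, ∑ i, ‖Ψ t i‖ ^ 2 = ∑ k, ‖t k‖ ^ 2 := by
    intro t
    have h := hadj (Ψ t) t
    rw [hinv] at h
    simp only [Complex.star_def, Complex.mul_conj'] at h
    exact_mod_cast h.symm
  have hinj : Function.Injective (Measure.map (WithLp.toLp 2 : (κ → ℂ) → EuclideanSpace ℂ κ)) :=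
    (MeasurableEquiv.toLp 2 (κ → ℂ)).map_measurableEquiv_injective
  have hp : IsProbabilityMeasure ((gaussianPi ι).map Φ) :=
    Measure.isProbabilityMeasure_map hΦ.aemeasurable
  apply hinj
  have h1 : IsProbabilityMeasure ((gaussianPi κ).map
      (WithLp.toLp 2 : (κ → ℂ) → EuclideanSpace ℂ κ)) :=
    Measure.isProbabilityMeasure_map (by fun_prop)
  have h2 : IsProbabilityMeasure (((gaussianPi ι).map Φ).map
      (WithLp.toLp 2 : (κ → ℂ) → EuclideanSpace ℂ κ)) :=
    Measure.isProbabilityMeasure_map (by fun_prop)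
  apply Measure.ext_of_charFun
  ext t
  have hL := charFun_map_toLp_gaussianPi (WithLp.toLp 2 (Ψ (WithLp.ofLp t)))
  rw [charFun_map_toLp_gaussianPi, charFun_apply,
    integral_map (by fun_prop) (by fun_prop), integral_map (by fun_prop) (by fun_prop)]
  rw [charFun_apply, integral_map (by fun_prop) (by fun_prop)] at hL
  have hn : ‖(WithLp.toLp 2 (Ψ (WithLp.ofLp t)) : EuclideanSpace ℂ ι)‖ ^ 2 = ‖t‖ ^ 2 := by
    rw [EuclideanSpace.norm_sq_eq, EuclideanSpace.norm_sq_eq]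
    exact hiso _
  rw [← Complex.ofReal_pow, hn, Complex.ofReal_pow] at hL
  rw [← hL]
  refine integral_congr_ae (.of_forall fun x => ?_)
  dsimp only
  rw [real_inner_comm, euclideanSpace_real_inner_eq, real_inner_comm, euclideanSpace_real_inner_eq]
  rw [← hadj]

/-! ### Logarithmic and second moments of Gaussian vectors. -/

-- Differentiating the Mellin transform of `e^(-t)` at `n + 1` brings down the factor `log t`. Decay
-- at infinity and boundedness at `0` justify this.
open Set in
lemma integrableOn_pow_mul_log_mul_exp_neg (n : ℕ) :
    IntegrableOn (fun t : ℝ => t ^ n * (Real.log t * Real.exp (-t))) (Ioi 0) := by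
  have h := (mellin_hasDerivAt_of_isBigO_rpow (E := ℂ) (f := fun t => (Real.exp (-t) : ℂ))
    (a := (n : ℝ) + 2) (b := 0) (s := n + 1) ?_ ?_ (by simp) ?_
      (by simp; positivity)).1
  · refine IntegrableOn.congr_fun (Integrable.re h) (fun t ht => ?_) measurableSet_Ioi
    simp only [add_sub_cancel_right, Complex.cpow_natCast]
    simp only [Complex.real_smul, smul_eq_mul]
    rw [← Complex.ofReal_pow, ← Complex.ofReal_mul, ← Complex.ofReal_mul]
    exact Complex.ofReal_re _
  · refine (Continuous.continuousOn ?_).locallyIntegrableOn measurableSet_Ioi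
    fun_prop
  · rw [← Asymptotics.isBigO_norm_left]
    simp_rw [Complex.norm_real, Asymptotics.isBigO_norm_left]
    simpa only [neg_one_mul] using (isLittleO_exp_neg_mul_rpow_atTop zero_lt_one _).isBigO
  · simp_rw [neg_zero, Real.rpow_zero]
    refine Asymptotics.isBigO_const_of_tendsto (y := (1 : ℂ)) ?_ one_ne_zero
    have hc : Continuous fun t : ℝ => (Real.exp (-t) : ℂ) := by fun_prop
    have h0 := (hc.tendsto 0).mono_left (nhdsWithin_le_nhds (s := Ioi 0))
    simpa using h0

-- Both sides are `Γ'(n + 1)`: one by differentiating the integral, the other from the known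
-- derivative at integers.
open Set in
lemma integral_pow_mul_log_mul_exp_neg (n : ℕ) :
    ∫ t in Ioi (0 : ℝ), t ^ n * (Real.log t * Real.exp (-t)) =
      n.factorial * (harmonic n - Real.eulerMascheroniConstant) := by
  have hre : 0 < ((n : ℂ) + 1).re := by simp; positivity
  have h1 := Complex.hasDerivAt_GammaIntegral hre
  have h2 : HasDerivAt Complex.GammaIntegral _ ((n : ℂ) + 1) :=
    (Complex.hasDerivAt_Gamma_nat n).congr_of_eventuallyEq <| by
      filter_upwards [(isOpen_lt continuous_const Complex.continuous_re).mem_nhds hre] with s hs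
      exact (Complex.Gamma_eq_integral hs).symm
  have h3 := h1.unique h2
  simp only [add_sub_cancel_right, Complex.cpow_natCast] at h3
  apply Complex.ofReal_injective
  rw [← integral_complex_ofReal]
  push_cast
  push_cast at h3
  rw [h3]
  ring

/-- A random variable that is almost surely positive and whose logarithm has mean `c`. -/
structure HasLogMean {Ω : Type*} [MeasurableSpace Ω] (P : Measure Ω) (Y : Ω → ℝ) (c : ℝ) :
    Prop where
  pos : ∀ᵐ ω ∂P, 0 < Y ω
  integrable : Integrable (fun ω => Real.log (Y ω)) P
  integral_eq : ∫ ω, Real.log (Y ω) ∂P = c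

namespace HasLogMean

variable {Ω Ω' : Type*} [MeasurableSpace Ω] [MeasurableSpace Ω'] {P : Measure Ω} {Y Z : Ω → ℝ}
  {c d : ℝ}

lemma congr (h : HasLogMean P Y c) (hYZ : Y =ᵐ[P] Z) : HasLogMean P Z c where
  pos := by filter_upwards [h.pos, hYZ] with ω h1 h2 using h2 ▸ h1
  integrable := h.integrable.congr <| by filter_upwards [hYZ] with ω h2; rw [h2]
  integral_eq := by
    rw [← h.integral_eq]
    refine integral_congr_ae ?_
    filter_upwards [hYZ] with ω h2
    rw [h2]

lemma mul (hY : HasLogMean P Y c) (hZ : HasLogMean P Z d) :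
    HasLogMean P (fun ω => Y ω * Z ω) (c + d) := by
  have h : (fun ω => Real.log (Y ω * Z ω)) =ᵐ[P] fun ω => Real.log (Y ω) + Real.log (Z ω) := by
    filter_upwards [hY.pos, hZ.pos] with ω h1 h2 using Real.log_mul h1.ne' h2.ne'
  refine ⟨?_, ?_, ?_⟩
  · filter_upwards [hY.pos, hZ.pos] with ω h1 h2 using mul_pos h1 h2
  · exact (hY.integrable.add hZ.integrable).congr h.symm
  · rw [integral_congr_ae h, integral_add hY.integrable hZ.integrable, hY.integral_eq,
      hZ.integral_eq]

lemma map_iff {X : Ω → Ω'} (hX : AEMeasurable X P) {f : Ω' → ℝ} (hf : Measurable f) :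
    HasLogMean (P.map X) f c ↔ HasLogMean P (fun ω => f (X ω)) c := by
  have hl : Measurable fun x => Real.log (f x) := hf.log
  have e1 := ae_map_iff hX (p := fun x => 0 < f x) (measurableSet_lt measurable_const hf)
  have e2 := integrable_map_measure (μ := P) (f := X) hl.aestronglyMeasurable hX
  have e3 := integral_map hX (hl.aestronglyMeasurable (μ := P.map X))
  constructor
  · rintro ⟨h1, h2, h3⟩
    exact ⟨e1.1 h1, e2.1 h2, e3.symm.trans h3⟩
  · rintro ⟨h1, h2, h3⟩
    exact ⟨e1.2 h1, e2.2 h2, e3.trans h3⟩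

end HasLogMean

open Set in
/-- The logarithm of the squared norm of a standard complex Gaussian vector in dimension `n + 1` has
mean `ψ (n + 1) = H_n - γ`. -/
lemma hasLogMean_euclideanGaussian (n : ℕ) :
    HasLogMean (euclideanGaussian (Fin (n + 1))) (fun x => ‖x‖ ^ 2)
      (harmonic n - Real.eulerMascheroniConstant) := by
  set E := EuclideanSpace ℂ (Fin (n + 1))
  have hd : Module.finrank ℝ E - 1 = 2 * n + 1 := by
    rw [← Module.finrank_mul_finrank ℝ ℂ, finrank_euclideanSpace, Complex.finrank_real_complex,
      Fintype.card_fin]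
    omega
  -- Polar coordinates followed by `t = y²` turn the radial density into a multiple of `t^n e^(-t)`.
  have key : ∀ g : ℝ → ℝ, EqOn
      (fun y : ℝ => y ^ (Module.finrank ℝ E - 1) •
        (Real.exp (-y ^ 2) / Real.pi ^ (n + 1) * g (y ^ 2)))
      (fun y => (Real.pi ^ (n + 1))⁻¹ * 2⁻¹ * ((2 * y ^ ((2 : ℝ) - 1)) •
        (fun t => t ^ n * (g t * Real.exp (-t))) (y ^ (2 : ℝ)))) (Ioi 0) := by
    intro g y hy
    rw [hd]
    norm_num
    field_simp
    ring
  have hint : ∀ g : ℝ → ℝ, ∫ x, g (‖x‖ ^ 2) ∂euclideanGaussian (Fin (n + 1)) =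
      (Module.finrank ℝ E * volume.real (Metric.ball (0 : E) 1) * (Real.pi ^ (n + 1))⁻¹ * 2⁻¹) *
        ∫ t in Ioi (0 : ℝ), t ^ n * (g t * Real.exp (-t)) := by
    intro g
    rw [integral_euclideanGaussian]
    simp only [Fintype.card_fin, smul_eq_mul]
    rw [integral_fun_norm_addHaar volume
      (fun y => Real.exp (-y ^ 2) / Real.pi ^ (n + 1) * g (y ^ 2)),
      setIntegral_congr_fun measurableSet_Ioi (key g), integral_const_mul,
      integral_comp_rpow_Ioi_of_pos
        (g := fun t => t ^ n * (g t * Real.exp (-t))) two_pos]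
    simp only [nsmul_eq_mul, smul_eq_mul]
    ring
  -- Total mass one determines the constant as `1 / n!`, so the volume of the unit ball need not be
  -- computed.
  have hone := hint fun _ => 1
  have hGam : ∫ t in Ioi (0 : ℝ), t ^ n * (1 * Real.exp (-t)) = n.factorial := by
    rw [← Real.Gamma_nat_eq_factorial, Real.Gamma_eq_integral (by positivity)]
    refine setIntegral_congr_fun measurableSet_Ioi fun t ht => ?_
    simp [mul_comm]
  rw [hGam] at hone
  simp only [integral_const, probReal_univ, smul_eq_mul, mul_one] at hone
  refine ⟨?_, ?_, ?_⟩
  · have h0 : ∀ᵐ x ∂(volume : Measure E), x ≠ 0 := by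
      simp [ae_iff]
    have : ∀ᵐ x ∂(euclideanGaussian (Fin (n + 1))), x ≠ 0 :=
      (withDensity_absolutelyContinuous _ _).ae_le h0
    filter_upwards [this] with x hx
    have := norm_pos_iff.2 hx
    positivity
  · rw [integrable_euclideanGaussian_iff]
    simp only [Fintype.card_fin]
    rw [integrable_fun_norm_addHaar volume
      (f := fun y => Real.exp (-y ^ 2) / Real.pi ^ (n + 1) * Real.log (y ^ 2)),
      integrableOn_congr_fun (key Real.log) measurableSet_Ioi]
    refine Integrable.const_mul ?_ _
    have := (integrableOn_Ioi_comp_rpow_iff' _ (two_ne_zero (α := ℝ))).2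
      (integrableOn_pow_mul_log_mul_exp_neg n)
    refine (this.const_mul 2).congr (.of_forall fun y => ?_)
    simp only [smul_eq_mul]
    ring
  · rw [hint, integral_pow_mul_log_mul_exp_neg, ← mul_assoc, ← hone, one_mul]

/-- The logarithm of the squared norm of a family of `n + 1` independent standard complex Gaussian
variables has mean `ψ (n + 1) = H_n - γ`. -/
lemma hasLogMean_gaussianPi (n : ℕ) :
    HasLogMean (gaussianPi (Fin (n + 1))) (fun x => ∑ i, ‖x i‖ ^ 2)
      (harmonic n - Real.eulerMascheroniConstant) := by
  have h := hasLogMean_euclideanGaussian n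
  rw [← map_toLp_gaussianPi, HasLogMean.map_iff (by fun_prop) (by fun_prop)] at h
  simpa only [EuclideanSpace.norm_sq_eq] using h

lemma lintegral_sq_enorm_stdComplexGaussian :
    ∫⁻ z, ENNReal.ofReal (‖z‖ ^ 2) ∂stdComplexGaussian = 1 := by
  have h := Complex.integral_rpow_mul_exp_neg_rpow (p := 2) (q := 2) one_le_two (by norm_num)
  have h1 : ∫ z : ℂ, Real.exp (-‖z‖ ^ 2) / Real.pi * ‖z‖ ^ 2 = 1 := by
    have e : ∀ z : ℂ, Real.exp (-‖z‖ ^ 2) / Real.pi * ‖z‖ ^ 2 =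
        Real.pi⁻¹ * (‖z‖ ^ (2 : ℝ) * Real.exp (-‖z‖ ^ (2 : ℝ))) := by
      intro z
      rw [Real.rpow_two]
      field_simp
    simp_rw [e]
    rw [integral_const_mul, h]
    norm_num [Real.Gamma_two, Real.pi_ne_zero]
  have hi : Integrable fun z : ℂ => Real.exp (-‖z‖ ^ 2) / Real.pi * ‖z‖ ^ 2 := by
    by_contra hc
    rw [integral_undef hc] at h1
    exact zero_ne_one h1
  rw [stdComplexGaussian, lintegral_withDensity_eq_lintegral_mul _ (by fun_prop) (by fun_prop),
    ← ENNReal.ofReal_one, ← h1, ofReal_integral_eq_lintegral_ofReal hi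
      (.of_forall fun x => by positivity)]
  refine lintegral_congr fun z => ?_
  rw [Pi.mul_apply, ← ENNReal.ofReal_mul (by positivity)]

open Matrix
open scoped ComplexOrder

/-! ### Algebra of Gram determinants. -/

section Algebra

variable {m n p : Type*} [Fintype m] [Fintype n] [Fintype p] [DecidableEq n]

/-- The Gram determinant `det (A† A)`, a nonnegative real number. -/
def gramDet (A : Matrix m n ℂ) : ℝ := (Aᴴ * A).det.re

lemma ofReal_gramDet (A : Matrix m n ℂ) : (gramDet A : ℂ) = (Aᴴ * A).det := by
  have h := (posSemidef_conjTranspose_mul_self A).det_nonneg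
  exact Complex.ext rfl (Complex.le_def.1 h).2

lemma gramDet_mul_square (A : Matrix m n ℂ) (B : Matrix n n ℂ) :
    gramDet (A * B) = gramDet A * ‖B.det‖ ^ 2 := by
  apply Complex.ofReal_injective
  rw [ofReal_gramDet, Complex.ofReal_mul, ofReal_gramDet, conjTranspose_mul,
    Matrix.mul_assoc, ← Matrix.mul_assoc Aᴴ, det_mul, det_mul, det_conjTranspose,
    Complex.ofReal_pow, ← Complex.mul_conj', Complex.star_def]
  ring

lemma gramDet_of_conjTranspose_mul_self_eq_one {U : Matrix m n ℂ} (hU : Uᴴ * U = 1) :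
    gramDet U = 1 := by
  rw [gramDet, hU, det_one, Complex.one_re]

/-- A factor `B` with `A† A = B† B` is invertible, and `U = A B⁻¹` then has orthonormal columns. -/
lemma exists_isometry_mul_of_gramDet_ne_zero {A : Matrix m n ℂ} (hA : gramDet A ≠ 0) :
    ∃ (U : Matrix m n ℂ) (B : Matrix n n ℂ), Uᴴ * U = 1 ∧ A = U * B := by
  classical
  obtain ⟨B, hB⟩ : ∃ B : Matrix n n ℂ, Aᴴ * A = Bᴴ * B := by
    open scoped MatrixOrder in
    exact CStarAlgebra.nonneg_iff_eq_star_mul_self.1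
      (nonneg_iff_posSemidef.2 (posSemidef_conjTranspose_mul_self A))
  have hdet : IsUnit B.det := by
    rw [isUnit_iff_ne_zero]
    intro h0
    apply hA
    rw [gramDet, hB, det_mul, h0, mul_zero, Complex.zero_re]
  refine ⟨A * B⁻¹, B, ?_, ?_⟩
  · rw [conjTranspose_mul, Matrix.mul_assoc, ← Matrix.mul_assoc Aᴴ, hB, Matrix.mul_assoc Bᴴ,
      mul_nonsing_inv _ hdet, Matrix.mul_one, ← conjTranspose_mul, mul_nonsing_inv _ hdet,
      conjTranspose_one]
  · rw [Matrix.mul_assoc, nonsing_inv_mul _ hdet, Matrix.mul_one]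

lemma gramDet_submatrix_equiv {l : Type*} [Fintype l] [DecidableEq l] (A : Matrix m n ℂ)
    (e : l ≃ n) : gramDet (A.submatrix id e) = gramDet A := by
  exact congrArg Complex.re (det_submatrix_equiv_self e (Aᴴ * A))

/-- Extend `g / ‖g‖` to an orthonormal basis and use the remaining vectors as columns; completeness
of the basis identifies `V V†` as the projection orthogonal to `g`. -/
lemma exists_isometry_orthogonal_complement {p : ℕ} {g : Fin (p + 1) → ℂ} (hg : g ≠ 0) :
    ∃ V : Matrix (Fin (p + 1)) (Fin p) ℂ, Vᴴ * V = 1 ∧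
      V * Vᴴ = 1 - ((∑ i, ‖g i‖ ^ 2 : ℝ) : ℂ)⁻¹ • vecMulVec g (star g) := by
  set w : EuclideanSpace ℂ (Fin (p + 1)) := WithLp.toLp 2 g with hw
  have hw0 : w ≠ 0 := by
    intro h
    exact hg (by simpa [hw] using h)
  have hwn : ‖w‖ ≠ 0 := norm_ne_zero_iff.2 hw0
  obtain ⟨b, hb⟩ := Orthonormal.exists_orthonormalBasis_extension_of_card_eq (𝕜 := ℂ)
    (E := EuclideanSpace ℂ (Fin (p + 1))) (ι := Fin (p + 1)) (by simp)
    (v := fun _ => ((‖w‖ : ℂ)⁻¹) • w) (s := {0}) (by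
      refine ⟨fun i => ?_, fun i j hij => absurd (Subsingleton.elim i j) hij⟩
      simp [Set.domRestrict, norm_smul, hwn])
  have hb0 := hb 0 rfl
  have hsq : ((∑ i, ‖g i‖ ^ 2 : ℝ) : ℂ) = (‖w‖ : ℂ) ^ 2 := by
    rw [← Complex.ofReal_pow, EuclideanSpace.norm_sq_eq]
  have horth : ∀ i j, ∑ k, star (b i k) * b j k = if i = j then 1 else 0 := by
    intro i j
    rw [← orthonormal_iff_ite.1 b.orthonormal i j, PiLp.inner_apply]
    exact Finset.sum_congr rfl fun k _ => by simp [mul_comm]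
  have hU : (Matrix.of fun i j => b j i)ᴴ * (Matrix.of fun i j => b j i) =
      (1 : Matrix (Fin (p + 1)) (Fin (p + 1)) ℂ) := by
    ext i j
    simp only [mul_apply, conjTranspose_apply, of_apply, horth, one_apply]
  have hU' := mul_eq_one_comm.1 hU
  refine ⟨Matrix.of fun i j => b j.succ i, ?_, ?_⟩
  · ext i j
    simp only [mul_apply, conjTranspose_apply, of_apply, horth, one_apply, Fin.succ_inj]
  · ext i j
    have h := congrFun (congrFun hU' i) j
    simp only [mul_apply, conjTranspose_apply, of_apply, Fin.sum_univ_succ, hb0] at h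
    rw [Matrix.sub_apply, ← h, Matrix.smul_apply, vecMulVec_apply, hsq]
    simp only [mul_apply, conjTranspose_apply, of_apply, PiLp.smul_apply, smul_eq_mul, star_mul',
      Complex.star_def, Pi.star_apply, map_inv₀, Complex.conj_ofReal, hw]
    ring

/-- Splitting off a column of a matrix: the Gram determinant is the squared norm of that column
times the Gram determinant of the projection of the other columns to its orthogonal complement. -/
lemma gramDet_fromCols_replicateCol (A : Matrix m n ℂ) {r : Type*} [Fintype r] [DecidableEq m]
    {g : m → ℂ} (hg : ∑ i, ‖g i‖ ^ 2 ≠ 0) {V : Matrix m r ℂ}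
    (hV : V * Vᴴ = 1 - ((∑ i, ‖g i‖ ^ 2 : ℝ) : ℂ)⁻¹ • vecMulVec g (star g)) :
    gramDet (fromCols A (replicateCol (Fin 1) g)) = (∑ i, ‖g i‖ ^ 2) * gramDet (Vᴴ * A) := by
  set s : ℝ := ∑ i, ‖g i‖ ^ 2
  have hs : (s : ℂ) ≠ 0 := by exact_mod_cast hg
  set c := replicateCol (Fin 1) g with hc
  have hD : cᴴ * c = (s : ℂ) • (1 : Matrix (Fin 1) (Fin 1) ℂ) := by
    ext i j
    rw [Subsingleton.elim i j]
    simp [hc, mul_apply, s, Complex.conj_mul']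
  have hcc : c * cᴴ = vecMulVec g (star g) := by
    ext i j
    simp [hc, mul_apply, vecMulVec_apply]
  -- This block is the scalar `s`, so its Schur complement is `A† (1 - c c† / s) A = A† V V† A`.
  let _ : Invertible (cᴴ * c) := ⟨(s : ℂ)⁻¹ • 1, by
    rw [hD, smul_mul_smul_comm, inv_mul_cancel₀ hs, Matrix.one_mul, one_smul], by
    rw [hD, smul_mul_smul_comm, mul_inv_cancel₀ hs, Matrix.one_mul, one_smul]⟩
  apply Complex.ofReal_injective
  rw [ofReal_gramDet, Complex.ofReal_mul, ofReal_gramDet,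
    conjTranspose_fromCols_eq_fromRows_conjTranspose, fromRows_mul_fromCols, det_fromBlocks₂₂]
  have hinv : ⅟(cᴴ * c) = (s : ℂ)⁻¹ • 1 := rfl
  have hdet : (cᴴ * c).det = s := by
    rw [hD]
    simp
  rw [hdet, hinv]
  congr 2
  rw [conjTranspose_mul, conjTranspose_conjTranspose, Matrix.mul_assoc Aᴴ V,
    ← Matrix.mul_assoc V, hV, ← hcc]
  simp only [Matrix.mul_smul, Matrix.smul_mul, Matrix.mul_one, Matrix.sub_mul, Matrix.mul_sub,
    Matrix.one_mul, Matrix.mul_assoc]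

end Algebra

/-! ### Laws of Gram determinants of Gaussian matrices. -/

section Laws

variable {m n p : Type*}

/-- The matrix with the given family of entries. -/
def toMat (x : m × n → ℂ) : Matrix m n ℂ := Matrix.of fun i j => x (i, j)

@[simp]
lemma toMat_apply (x : m × n → ℂ) (i : m) (j : n) : toMat x i j = x (i, j) := rfl

lemma measurable_mul_apply [Fintype m] {Ω : Type*} {mΩ : MeasurableSpace Ω}
    {A : Ω → Matrix p m ℂ} {B : Ω → Matrix m n ℂ} (hA : ∀ i j, Measurable fun ω => A ω i j)
    (hB : ∀ i j, Measurable fun ω => B ω i j) (i : p) (j : n) :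
    Measurable fun ω => (A ω * B ω) i j := by
  simp only [mul_apply]
  exact Finset.measurable_sum _ fun k _ => (hA _ _).mul (hB _ _)

lemma measurable_toMat_mul [Fintype m] (U : Matrix m n ℂ) :
    Measurable fun (x : p × m → ℂ) (ij : p × n) => (toMat x * U) ij.1 ij.2 := by
  simp only [mul_apply, toMat_apply]
  fun_prop

lemma measurable_mul_toMat [Fintype m] (V : Matrix p m ℂ) :
    Measurable fun (x : m × n → ℂ) (ij : p × n) => (V * toMat x) ij.1 ij.2 := by
  simp only [mul_apply, toMat_apply]
  fun_prop

variable [Fintype m] [Fintype n] [Fintype p]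

lemma measurable_gramDet_of_entries [DecidableEq n] {Ω : Type*} [MeasurableSpace Ω]
    {A : Ω → Matrix m n ℂ} (hA : ∀ i j, Measurable fun ω => A ω i j) :
    Measurable fun ω => gramDet (A ω) := by
  simp only [gramDet, det_apply, mul_apply, conjTranspose_apply]
  refine Complex.measurable_re.comp ?_
  refine Finset.measurable_sum _ fun σ _ => ?_
  refine Measurable.const_smul ?_ _
  refine Finset.measurable_prod _ fun i _ => ?_
  refine Finset.measurable_sum _ fun k _ => ?_
  exact (Complex.continuous_conj.measurable.comp (hA _ _)).mul (hA _ _)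

lemma measurable_gramDet_toMat [DecidableEq n] :
    Measurable fun x : m × n → ℂ => gramDet (toMat x) :=
  measurable_gramDet_of_entries fun i j => measurable_pi_apply (i, j)

/-- Right multiplication by an isometry preserves the law of a Gaussian matrix. -/
lemma map_gaussianPi_mul_isometry [DecidableEq n] {U : Matrix m n ℂ} (hU : Uᴴ * U = 1) :
    (gaussianPi (p × m)).map (fun x ij => (toMat x * U) ij.1 ij.2) = gaussianPi (p × n) := by
  refine map_gaussianPi_of_adjoint (Ψ := fun t ik => (toMat t * Uᴴ) ik.1 ik.2)
    (measurable_toMat_mul U) ?_ ?_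
  · intro x t
    simp only [Fintype.sum_prod_type, mul_apply, toMat_apply, conjTranspose_apply, star_sum,
      star_mul', star_star, Finset.sum_mul, Finset.mul_sum]
    refine Finset.sum_congr rfl fun i _ => ?_
    rw [Finset.sum_comm]
    exact Finset.sum_congr rfl fun k _ => Finset.sum_congr rfl fun j _ => by ring
  · intro t
    funext ij
    change (toMat t * Uᴴ * U) ij.1 ij.2 = _
    rw [Matrix.mul_assoc, hU, Matrix.mul_one]
    rfl

/-- Left multiplication by the adjoint of an isometry preserves the law of a Gaussian matrix. -/
lemma map_gaussianPi_conjTranspose_mul [DecidableEq p] {V : Matrix m p ℂ} (hV : Vᴴ * V = 1) :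
    (gaussianPi (m × n)).map (fun x ij => (Vᴴ * toMat x) ij.1 ij.2) = gaussianPi (p × n) := by
  refine map_gaussianPi_of_adjoint (Ψ := fun t ik => (V * toMat t) ik.1 ik.2)
    (measurable_mul_toMat Vᴴ) ?_ ?_
  · intro x t
    simp only [Fintype.sum_prod_type_right, mul_apply, toMat_apply, conjTranspose_apply, star_sum,
      star_mul', Finset.sum_mul, Finset.mul_sum]
    refine Finset.sum_congr rfl fun i _ => ?_
    rw [Finset.sum_comm]
    exact Finset.sum_congr rfl fun k _ => Finset.sum_congr rfl fun j _ => by ring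
  · intro t
    funext ij
    change (Vᴴ * (V * toMat t)) ij.1 ij.2 = _
    rw [← Matrix.mul_assoc, hV, Matrix.one_mul]
    rfl

/-- The law of the Gram determinant of a Gaussian matrix. -/
def gramLaw (m n : Type*) [Fintype m] [Fintype n] [DecidableEq n] : Measure ℝ :=
  (gaussianPi (m × n)).map fun x => gramDet (toMat x)

/-- With `A = U B`, the factor `|det B|²` cancels and `X U` is a Gaussian matrix whatever `A` is. -/
lemma map_gramDet_mul_div [DecidableEq n] {A : Matrix m n ℂ} (hA : 0 < gramDet A) :
    (gaussianPi (p × m)).map (fun x => gramDet (toMat x * A) / gramDet A) = gramLaw p n := by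
  obtain ⟨U, B, hU, rfl⟩ := exists_isometry_mul_of_gramDet_ne_zero hA.ne'
  rw [gramDet_mul_square, gramDet_of_conjTranspose_mul_self_eq_one hU, one_mul] at hA ⊢
  simp only [← Matrix.mul_assoc, gramDet_mul_square, mul_div_cancel_right₀ _ hA.ne']
  rw [gramLaw, ← map_gaussianPi_mul_isometry (p := p) hU, Measure.map_map]
  · rfl
  · exact measurable_gramDet_toMat
  · exact measurable_toMat_mul U

/-- Dividing by the squared norm of `g` leaves the Gram determinant of `V† X`, a Gaussian matrix
with one row fewer. -/
lemma map_gramDet_fromCols_div {n : Type*} [Fintype n] [DecidableEq n] {p : ℕ}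
    {g : Fin (p + 1) → ℂ} (hg : 0 < ∑ i, ‖g i‖ ^ 2) :
    (gaussianPi (Fin (p + 1) × n)).map (fun x =>
      gramDet (fromCols (toMat x) (replicateCol (Fin 1) g)) / ∑ i, ‖g i‖ ^ 2) =
      gramLaw (Fin p) n := by
  have hg0 : g ≠ 0 := by
    rintro rfl
    simp at hg
  obtain ⟨V, hV, hV'⟩ := exists_isometry_orthogonal_complement hg0
  simp only [gramDet_fromCols_replicateCol _ hg.ne' hV', mul_div_cancel_left₀ _ hg.ne']
  rw [gramLaw, ← map_gaussianPi_conjTranspose_mul (n := n) hV, Measure.map_map]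
  · rfl
  · exact measurable_gramDet_toMat
  · exact measurable_mul_toMat Vᴴ

end Laws

/-! ### Independence and additivity of log-means. -/

section Independence

variable {Ω : Type*} [MeasurableSpace Ω] {P : Measure Ω}

/-- If the conditional law of `F (X, Y)` given `Y` is always `ν`, then `F (X, Y)` has law `ν`. -/
lemma map_prod_eq_of_forall_map_eq {α β γ : Type*} [MeasurableSpace α] [MeasurableSpace β]
    [MeasurableSpace γ] {μ : Measure α} {τ : Measure β} [SFinite μ] [IsProbabilityMeasure τ]
    {ν : Measure γ} {F : α × β → γ} (hF : Measurable F)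
    (h : ∀ᵐ y ∂τ, μ.map (fun x => F (x, y)) = ν) : (μ.prod τ).map F = ν := by
  ext s hs
  rw [Measure.map_apply hF hs, Measure.prod_apply_symm (hF hs)]
  have : ∀ᵐ y ∂τ, μ ((fun x => (x, y)) ⁻¹' (F ⁻¹' s)) = ν s := by
    filter_upwards [h] with y hy
    rw [← hy, Measure.map_apply (f := fun x => F (x, y)) (hF.comp (by fun_prop)) hs]
    rfl
  rw [lintegral_congr_ae this, lintegral_const, measure_univ, mul_one]

/-- If, given `Y`, the quotient `F (X, Y) / D Y` has a law `ν` that does not depend on `Y`, then the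
means of the logarithms of `D Y` and of `ν` add up to that of `F (X, Y)`. -/
lemma HasLogMean.of_indepFun [IsProbabilityMeasure P] {α β : Type*} [MeasurableSpace α]
    [MeasurableSpace β] {X : Ω → α} {Y : Ω → β} {μ : Measure α} [SFinite μ] (hX : HasLaw X μ P)
    (hY : Measurable Y) (hXY : IndepFun X Y P) {F : α × β → ℝ} {D : β → ℝ} (hF : Measurable F)
    (hD : Measurable D) {ν : Measure ℝ}
    (hν : ∀ y, 0 < D y → μ.map (fun x => F (x, y) / D y) = ν) {c d : ℝ}
    (hc : HasLogMean P (fun ω => D (Y ω)) c) (hd : HasLogMean ν (fun r => r) d) :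
    HasLogMean P (fun ω => F (X ω, Y ω)) (c + d) := by
  have hXY' := (indepFun_iff_hasLaw_prodMk_prod hX 
    (⟨hY.aemeasurable, rfl⟩ : HasLaw Y (P.map Y) P)).1 hXY
  have hR : Measurable fun z : α × β => F z / D z.2 := hF.div (hD.comp measurable_snd)
  have : IsProbabilityMeasure (P.map Y) := Measure.isProbabilityMeasure_map hY.aemeasurable
  have hlaw : (μ.prod (P.map Y)).map (fun z => F z / D z.2) = ν := by
    refine map_prod_eq_of_forall_map_eq hR ?_
    have : ∀ᵐ y ∂(P.map Y), 0 < D y :=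
      (ae_map_iff hY.aemeasurable (measurableSet_lt measurable_const hD)).2 hc.pos
    filter_upwards [this] with y hy using hν y hy
  rw [← hlaw, HasLogMean.map_iff hR.aemeasurable measurable_id', ← hXY'.map_eq,
    HasLogMean.map_iff hXY'.aemeasurable hR] at hd
  refine (hc.mul hd).congr ?_
  filter_upwards [hc.pos] with ω hω
  exact mul_div_cancel₀ _ hω.ne'

/-- Functions of disjoint subfamilies of an independent family are independent. -/
lemma indepFun_of_measurable_iSup_comap {ι : Type*} {Z : ι → Ω → ℂ} (hZ : ∀ i, Measurable (Z i))
    (hind : iIndepFun Z P) {S T : Set ι} (hST : Disjoint S T) {α β : Type*} [MeasurableSpace α]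
    [MeasurableSpace β] {X : Ω → α} {Y : Ω → β}
    (hX : Measurable[⨆ i ∈ S, MeasurableSpace.comap (Z i) inferInstance] X)
    (hY : Measurable[⨆ i ∈ T, MeasurableSpace.comap (Z i) inferInstance] Y) :
    IndepFun X Y P := by
  have h := indep_iSup_of_disjoint (fun i => (hZ i).comap_le) hind hST
  exact indep_of_indep_of_le_left (indep_of_indep_of_le_right h hY.comap_le) hX.comap_le

lemma measurable_iSup_comap_of_mem {Ω ι : Type*} (Z : ι → Ω → ℂ) {S : Set ι} {i : ι} (hi : i ∈ S) :
    Measurable[⨆ i ∈ S, MeasurableSpace.comap (Z i) inferInstance] (Z i) :=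
  measurable_iff_comap_le.2 (le_iSup₂_of_le i hi le_rfl)

end Independence

/-- The logarithm of the Gram determinant of a `p × n` Gaussian matrix has mean
`∑_{l=1}^n ψ (p - l + 1)`. -/
lemma hasLogMean_gramDet_gaussianPi {n p : ℕ} (hnp : n ≤ p) :
    HasLogMean (gaussianPi (Fin p × Fin n)) (fun x => gramDet (toMat x))
      (∑ l ∈ Finset.range n,
        ((harmonic (p - (l + 1)) : ℝ) - Real.eulerMascheroniConstant)) := by
  induction n generalizing p with
  | zero =>
    have h : ∀ x : Fin p × Fin 0 → ℂ, gramDet (toMat x) = 1 := fun x => by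
      simp [gramDet]
    exact ⟨by simp [h], by simp [h], by simp [h]⟩
  | succ n ih =>
    obtain ⟨p, rfl⟩ : ∃ q, p = q + 1 := ⟨p - 1, by omega⟩
    -- Projecting away the last column removes one row and one column, so the induction must cover
    -- all `p`.
    have hν : HasLogMean (gramLaw (Fin p) (Fin n)) (fun r => r) _ :=
      (HasLogMean.map_iff measurable_gramDet_toMat.aemeasurable
        measurable_id).2 (ih (p := p) (by omega))
    let Z : Fin (p + 1) × Fin (n + 1) → (Fin (p + 1) × Fin (n + 1) → ℂ) → ℂ := fun e x => x e
    have hZ : ∀ e, Measurable (Z e) := fun e => measurable_pi_apply e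
    have hind : iIndepFun Z (gaussianPi (Fin (p + 1) × Fin (n + 1))) :=
      iIndepFun_pi (μ := fun _ => stdComplexGaussian) (X := fun _ x => x)
        (fun _ => aemeasurable_id)
    have hlaw : ∀ e, HasLaw (Z e) stdComplexGaussian (gaussianPi (Fin (p + 1) × Fin (n + 1))) :=
      fun e => (measurePreserving_eval (fun _ => stdComplexGaussian) e).hasLaw
    have hX : HasLaw (fun ω (e : Fin (p + 1) × Fin n) => Z (e.1, e.2.castSucc) ω)
        (gaussianPi (Fin (p + 1) × Fin n)) (gaussianPi (Fin (p + 1) × Fin (n + 1))) := by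
      refine iIndepFun.hasLaw_pi (fun e => hlaw _)
        (hind.precomp (g := fun e : Fin (p + 1) × Fin n => (e.1, e.2.castSucc)) ?_)
      intro a b hab
      simp only [Prod.mk.injEq, Fin.castSucc_inj] at hab
      exact Prod.ext hab.1 hab.2
    have hY : HasLaw (fun ω (i : Fin (p + 1)) => Z (i, Fin.last n) ω)
        (gaussianPi (Fin (p + 1))) (gaussianPi (Fin (p + 1) × Fin (n + 1))) := by
      refine iIndepFun.hasLaw_pi (fun e => hlaw _)
        (hind.precomp (g := fun i : Fin (p + 1) => (i, Fin.last n)) ?_)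
      intro a b hab
      simpa using hab
    have hXY : IndepFun (fun ω (e : Fin (p + 1) × Fin n) => Z (e.1, e.2.castSucc) ω)
        (fun ω (i : Fin (p + 1)) => Z (i, Fin.last n) ω)
        (gaussianPi (Fin (p + 1) × Fin (n + 1))) := by
      refine indepFun_of_measurable_iSup_comap hZ hind (S := {e | e.2 ≠ Fin.last n})
        (T := {e | e.2 = Fin.last n}) ?_ ?_ ?_
      · exact Set.disjoint_left.2 fun e h1 h2 => h1 h2
      · exact @measurable_pi_lambda _ _ _ (_) _ _ fun e =>
          measurable_iSup_comap_of_mem Z (Fin.castSucc_lt_last e.2).ne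
      · exact @measurable_pi_lambda _ _ _ (_) _ _ fun i => measurable_iSup_comap_of_mem Z rfl
    have hc := (HasLogMean.map_iff hY.aemeasurable (f := fun g => ∑ i, ‖g i‖ ^ 2)
      (by fun_prop)).1 (hY.map_eq ▸ hasLogMean_gaussianPi p)
    have h := HasLogMean.of_indepFun hX (by fun_prop) hXY
      (F := fun z => gramDet (fromCols (toMat z.1) (replicateCol (Fin 1) z.2)))
      (D := fun g => ∑ i, ‖g i‖ ^ 2)
      (measurable_gramDet_of_entries fun i j => by rcases j with j | j <;> simp <;> fun_prop)
      (by fun_prop) (fun g hg => map_gramDet_fromCols_div hg) hc hν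
    -- The split-off column is the term `l = 0`; the other terms shift onto the induction
    -- hypothesis.
    rw [Finset.sum_range_succ', add_comm (Finset.sum _ _)]
    simp only [Nat.add_sub_add_right, Nat.sub_zero]
    refine h.congr (.of_forall fun x => ?_)
    dsimp only
    rw [← gramDet_submatrix_equiv (toMat x) (finSumFinEquiv (m := n) (n := 1))]
    congr 1
    ext i j
    rcases j with j | j
    · rfl
    · rw [Subsingleton.elim j 0]
      rfl

/-- The squared Frobenius norm of a matrix. -/
def frobSq {m n : Type*} [Fintype m] [Fintype n] (A : Matrix m n ℂ) : ℝ := ∑ i, ∑ j, ‖A i j‖ ^ 2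

lemma frobSq_nonneg {m n : Type*} [Fintype m] [Fintype n] (A : Matrix m n ℂ) : 0 ≤ frobSq A := by
  unfold frobSq; positivity

lemma trace_conjTranspose_mul_self_eq_frobSq {m n : Type*} [Fintype m] [Fintype n]
    (A : Matrix m n ℂ) : (Aᴴ * A).trace = frobSq A := by
  simp only [trace, diag_apply, mul_apply, conjTranspose_apply, frobSq]
  rw [Finset.sum_comm]
  push_cast
  simp only [Complex.star_def, Complex.conj_mul']

/-! ### Deterministic bounds on the capacity. -/

section Eigenvalues

variable {m n : ℕ} (H : Matrix (Fin m) (Fin n) ℂ)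

/-- The eigenvalues of `H† H`. -/
def gramEigenvalues : Fin n → ℝ := (isHermitian_conjTranspose_mul_self H).eigenvalues

lemma gramEigenvalues_nonneg (i : Fin n) : 0 ≤ gramEigenvalues H i :=
  eigenvalues_conjTranspose_mul_self_nonneg H i

lemma sum_gramEigenvalues : ∑ i, gramEigenvalues H i = frobSq H := by
  apply Complex.ofReal_injective
  rw [← trace_conjTranspose_mul_self_eq_frobSq,
    (isHermitian_conjTranspose_mul_self H).trace_eq_sum_eigenvalues]
  simp [gramEigenvalues]

lemma prod_gramEigenvalues : ∏ i, gramEigenvalues H i = gramDet H := by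
  apply Complex.ofReal_injective
  rw [ofReal_gramDet, (isHermitian_conjTranspose_mul_self H).det_eq_prod_eigenvalues]
  simp [gramEigenvalues]

lemma det_one_add_smul_gram (q : ℝ) :
    (1 + (q : ℂ) • (Hᴴ * H)).det = ∏ i, ((1 + q * gramEigenvalues H i : ℝ) : ℂ) := by
  have hA := isHermitian_conjTranspose_mul_self H
  have h := hA.spectral_theorem
  set U := hA.eigenvectorUnitary
  rw [Unitary.conjStarAlgAut_apply] at h
  have hUU : (U : Matrix (Fin n) (Fin n) ℂ) * star (U : Matrix (Fin n) (Fin n) ℂ) = 1 :=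
    Unitary.coe_mul_star_self U
  have hdiag : diagonal (fun i => ((1 + q * gramEigenvalues H i : ℝ) : ℂ)) =
      1 + (q : ℂ) • diagonal (RCLike.ofReal ∘ hA.eigenvalues) := by
    ext i j
    by_cases hij : i = j
    · subst hij
      simp [gramEigenvalues]
    · simp [hij]
  have h1 : 1 + (q : ℂ) • (Hᴴ * H) = (U : Matrix (Fin n) (Fin n) ℂ) *
      diagonal (fun i => ((1 + q * gramEigenvalues H i : ℝ) : ℂ)) *
      star (U : Matrix (Fin n) (Fin n) ℂ) := by
    rw [hdiag, Matrix.mul_add, Matrix.add_mul, Matrix.mul_one, hUU, Matrix.mul_smul,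
      Matrix.smul_mul, ← h]
  rw [h1, det_mul_right_comm, hUU, Matrix.one_mul, det_diagonal]

variable {q : ℝ}

lemma capacity_eq_sum_log (hq : 0 ≤ q) :
    capacity q H = ∑ i, Real.log (1 + q * gramEigenvalues H i) := by
  rw [capacity, det_one_add_smul_gram, ← Complex.ofReal_prod, Complex.ofReal_re, Real.log_prod]
  intro i _
  have := gramEigenvalues_nonneg H i
  positivity

lemma capacity_nonneg (hq : 0 ≤ q) : 0 ≤ capacity q H := by
  rw [capacity_eq_sum_log H hq]
  refine Finset.sum_nonneg fun i _ => Real.log_nonneg ?_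
  have := gramEigenvalues_nonneg H i
  nlinarith [mul_nonneg hq this]

/-- The tangent line of the logarithm bounds the capacity from above. -/
lemma capacity_le (hq : 0 ≤ q) {a : ℝ} (ha : 0 < a) :
    capacity q H ≤ n * Real.log a + (n + q * frobSq H - n * a) / a := by
  have h : ∀ i, Real.log (1 + q * gramEigenvalues H i) ≤
      Real.log a + (1 + q * gramEigenvalues H i - a) / a := by
    intro i
    have hpos : 0 < 1 + q * gramEigenvalues H i := by
      have := gramEigenvalues_nonneg H i
      positivity
    have := Real.log_le_sub_one_of_pos (div_pos hpos ha)
    rw [Real.log_div hpos.ne' ha.ne'] at this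
    rw [sub_div, div_self ha.ne']
    linarith
  rw [capacity_eq_sum_log H hq]
  refine (Finset.sum_le_sum fun i _ => h i).trans (le_of_eq ?_)
  rw [Finset.sum_add_distrib, ← Finset.sum_div, Finset.sum_sub_distrib, Finset.sum_add_distrib,
    ← Finset.mul_sum, sum_gramEigenvalues]
  simp

/-- Convexity of `exp` between `0` and `log t - c` with weights `1 - s` and `s`, where `s` is the
slope `q e^c / (1 + q e^c)` of the tangent. -/
lemma log_one_add_mul_exp_tangent (hq : 0 ≤ q) {t : ℝ} (ht : 0 < t) (c : ℝ) :
    Real.log (1 + q * Real.exp c) +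
      q * Real.exp c / (1 + q * Real.exp c) * (Real.log t - c) ≤ Real.log (1 + q * t) := by
  set b := 1 + q * Real.exp c with hb
  have hbpos : 0 < b := by positivity
  set s := q * Real.exp c / b with hs
  have hs0 : 0 ≤ s := by positivity
  have hs1 : 1 - s = 1 / b := by
    rw [hs, hb]
    field_simp
    ring
  have hs1' : 0 ≤ 1 - s := by rw [hs1]; positivity
  have hconv := convexOn_exp.2 (Set.mem_univ 0) (Set.mem_univ (Real.log t - c)) hs1' hs0
    (by ring)
  simp only [smul_eq_mul, mul_zero, zero_add, Real.exp_zero, mul_one] at hconv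
  rw [Real.exp_sub, Real.exp_log ht, hs1] at hconv
  have he : 1 / b + s * (t / Real.exp c) = (1 + q * t) / b := by
    rw [hs]
    have := Real.exp_pos c
    field_simp
  rw [he] at hconv
  have hpos : 0 < 1 + q * t := by positivity
  have := (Real.le_log_iff_exp_le (div_pos hpos hbpos)).2 hconv
  rw [Real.log_div hpos.ne' hbpos.ne'] at this
  linarith

/-- The tangent line of the convex function `x ↦ ln (1 + q e^x)` bounds the capacity from below. -/
lemma le_capacity (hq : 0 ≤ q) (hH : 0 < gramDet H) (c : ℝ) :
    n * Real.log (1 + q * Real.exp c) +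
      q * Real.exp c / (1 + q * Real.exp c) * (Real.log (gramDet H) - n * c) ≤ capacity q H := by
  have hpos : ∀ i, 0 < gramEigenvalues H i := by
    intro i
    refine (gramEigenvalues_nonneg H i).lt_of_ne' fun h0 => hH.ne' ?_
    rw [← prod_gramEigenvalues]
    exact Finset.prod_eq_zero (Finset.mem_univ i) h0
  rw [capacity_eq_sum_log H hq]
  refine (le_of_eq ?_).trans
    (Finset.sum_le_sum fun i _ => log_one_add_mul_exp_tangent hq (hpos i) c)
  rw [Finset.sum_add_distrib, ← Finset.mul_sum, Finset.sum_sub_distrib, ← prod_gramEigenvalues,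
    Real.log_prod fun i _ => (hpos i).ne']
  simp

end Eigenvalues

/-- A Gaussian matrix with `p` rows multiplies the mean squared Frobenius norm by `p`. -/
lemma lintegral_frobSq_mul {m n p : Type*} [Fintype m] [Fintype n] [Fintype p]
    (A : Matrix m n ℂ) :
    ∫⁻ x, ENNReal.ofReal (frobSq (toMat x * A)) ∂gaussianPi (p × m) =
      Fintype.card p * ENNReal.ofReal (frobSq A) := by
  classical
  have hentry : ∀ (i : p) (v : m → ℂ),
      ∫⁻ x, ENNReal.ofReal (‖∑ k, x (i, k) * v k‖ ^ 2) ∂gaussianPi (p × m) =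
        ENNReal.ofReal (∑ k, ‖v k‖ ^ 2) := by
    intro i v
    by_cases hv : ∑ k, ‖v k‖ ^ 2 = 0
    · have hv0 : ∀ k, v k = 0 := by
        intro k
        have := (Finset.sum_eq_zero_iff_of_nonneg fun k _ => by positivity).1 hv k
          (Finset.mem_univ k)
        simpa using this
      simp [hv0]
    set s := ∑ k, ‖v k‖ ^ 2 with hs
    have hs0 : 0 ≤ s := by positivity
    have hsp : 0 < s := hs0.lt_of_ne' hv
    set r := Real.sqrt s
    have hr : r ^ 2 = s := Real.sq_sqrt hs0
    have hrp : 0 < r := Real.sqrt_pos.2 hsp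
    -- The normalised vector is a one-column isometry, so each entry is `r = ‖v‖` times a standard
    -- Gaussian.
    let U : Matrix m (Fin 1) ℂ := Matrix.of fun k _ => (r : ℂ)⁻¹ * v k
    have hU : Uᴴ * U = 1 := by
      ext a b
      rw [Subsingleton.elim a b]
      have : ∀ k, star ((r : ℂ)⁻¹ * v k) * ((r : ℂ)⁻¹ * v k) =
          (s : ℂ)⁻¹ * ((‖v k‖ ^ 2 : ℝ) : ℂ) := by
        intro k
        rw [Complex.star_def, Complex.conj_mul', norm_mul, ← hr]
        simp [mul_pow, abs_of_pos hrp]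
      simp only [mul_apply, conjTranspose_apply, U, of_apply, one_apply_eq, this]
      rw [← Finset.mul_sum, ← Complex.ofReal_sum, ← hs, inv_mul_cancel₀]
      exact_mod_cast hv
    have hlaw : MeasurePreserving (fun x : p × m → ℂ => (toMat x * U) i 0)
        (gaussianPi (p × m)) stdComplexGaussian :=
      (measurePreserving_eval (fun _ : p × Fin 1 => stdComplexGaussian) (i, 0)).comp
        ⟨measurable_toMat_mul U, map_gaussianPi_mul_isometry hU⟩
    have h := hlaw.lintegral_comp (f := fun z => ENNReal.ofReal (‖z‖ ^ 2)) (by fun_prop)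
    rw [lintegral_sq_enorm_stdComplexGaussian] at h
    have he : ∀ x : p × m → ℂ, ENNReal.ofReal (‖∑ k, x (i, k) * v k‖ ^ 2) =
        ENNReal.ofReal s * ENNReal.ofReal (‖(toMat x * U) i 0‖ ^ 2) := by
      intro x
      rw [← ENNReal.ofReal_mul hs0, ← hr, ← mul_pow]
      congr 2
      rw [mul_apply]
      simp only [toMat_apply, U, of_apply]
      have : ∀ k, x (i, k) * ((r : ℂ)⁻¹ * v k) = (r : ℂ)⁻¹ * (x (i, k) * v k) := fun k => by ring
      simp only [this]
      rw [← Finset.mul_sum, norm_mul, norm_inv, Complex.norm_real, Real.norm_of_nonneg hrp.le,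
        mul_inv_cancel_left₀ hrp.ne']
    simp only [he]
    rw [lintegral_const_mul' _ _ ENNReal.ofReal_ne_top, h, mul_one]
  have hexp : ∀ x : p × m → ℂ, ENNReal.ofReal (frobSq (toMat x * A)) =
      ∑ i, ∑ j, ENNReal.ofReal (‖∑ k, x (i, k) * A k j‖ ^ 2) := by
    intro x
    rw [frobSq, ENNReal.ofReal_sum_of_nonneg fun i _ => by positivity]
    refine Finset.sum_congr rfl fun i _ => ?_
    rw [ENNReal.ofReal_sum_of_nonneg fun i _ => by positivity]
    rfl
  simp only [hexp]
  rw [lintegral_finsetSum _ fun i _ => by fun_prop]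
  have hrow : ∀ i : p, ∫⁻ x, ∑ j, ENNReal.ofReal (‖∑ k, x (i, k) * A k j‖ ^ 2)
      ∂gaussianPi (p × m) = ∑ j, ENNReal.ofReal (∑ k, ‖A k j‖ ^ 2) := by
    intro i
    rw [lintegral_finsetSum _ fun j _ => by fun_prop]
    exact Finset.sum_congr rfl fun j _ => hentry i fun k => A k j
  simp only [hrow]
  rw [Finset.sum_const, Finset.card_univ, nsmul_eq_mul,
    ← ENNReal.ofReal_sum_of_nonneg fun i _ => by positivity, Finset.sum_comm]
  rfl

/-! ### The constant `g` and the digamma function. -/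

section Constants

lemma digamma_natCast_add_one (n : ℕ) :
    digamma ((n : ℝ) + 1) = harmonic n - Real.eulerMascheroniConstant := by
  have h : (n.factorial : ℝ) ≠ 0 := by positivity
  rw [digamma, logDeriv_apply, Real.deriv_Gamma_nat, Real.Gamma_nat_eq_factorial,
    mul_div_cancel_left₀ _ h]
  ring

lemma sum_Icc_one_div_eq_harmonic (n : ℕ) :
    ∑ r ∈ Finset.Icc 1 n, 1 / (r : ℝ) = harmonic n := by
  rw [harmonic_eq_sum_Icc]
  push_cast
  simp only [one_div]

variable {K : ℕ} {N : Fin (K + 1) → ℕ}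

lemma gConst_eq_digamma (hN0 : 1 ≤ N 0) (hmin : ∀ k, N 0 ≤ N k) :
    gConst N = K * Real.eulerMascheroniConstant +
      (1 / (N 0 : ℝ)) * ∑ k : Fin K, ∑ l ∈ Finset.Icc 1 (N 0),
        digamma ((N k.succ : ℝ) - l + 1) := by
  have h0 : (N 0 : ℝ) ≠ 0 := by positivity
  have h : ∀ k : Fin K, ∀ l ∈ Finset.Icc 1 (N 0), digamma ((N k.succ : ℝ) - l + 1) =
      (harmonic (N k.succ - l) : ℝ) - Real.eulerMascheroniConstant := by
    intro k l hl
    have hl' : l ≤ N k.succ := (Finset.mem_Icc.1 hl).2.trans (hmin _)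
    rw [← Nat.cast_sub hl', digamma_natCast_add_one]
  rw [Finset.sum_congr rfl fun k _ => Finset.sum_congr rfl (h k), gConst]
  simp only [sum_Icc_one_div_eq_harmonic, Finset.sum_sub_distrib, Finset.sum_const, Nat.card_Icc,
    Finset.card_univ, Fintype.card_fin, nsmul_eq_mul, Nat.add_sub_cancel]
  field_simp
  ring

lemma sum_log_means_eq (hN0 : 1 ≤ N 0) :
    ∑ k : Fin K, ∑ l ∈ Finset.range (N 0),
        ((harmonic (N k.succ - (l + 1)) : ℝ) - Real.eulerMascheroniConstant) =
      N 0 * (gConst N - K * Real.eulerMascheroniConstant) := by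
  have h0 : (N 0 : ℝ) ≠ 0 := by positivity
  have h : ∀ k : Fin K, ∑ l ∈ Finset.Icc 1 (N 0), (harmonic (N k.succ - l) : ℝ) =
      ∑ l ∈ Finset.range (N 0), (harmonic (N k.succ - (l + 1)) : ℝ) := by
    intro k
    rw [Finset.range_eq_Ico,
      Finset.sum_Ico_add' (fun l => (harmonic (N k.succ - l) : ℝ)) 0 (N 0) 1]
    rfl
  simp only [gConst, sum_Icc_one_div_eq_harmonic, h, Finset.sum_sub_distrib, Finset.sum_const,
    Finset.card_range, Finset.card_univ, Fintype.card_fin, nsmul_eq_mul]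
  field_simp

end Constants

/-! ### The product channel and its ergodic capacity. -/

section Channel

variable {K : ℕ} {N : Fin (K + 1) → ℕ}

lemma partialProduct_zero (Q : (k : Fin K) → Matrix (Fin (N k.succ)) (Fin (N k.castSucc)) ℂ) :
    partialProduct N Q 0 = 1 := rfl

lemma partialProduct_succ (Q : (k : Fin K) → Matrix (Fin (N k.succ)) (Fin (N k.castSucc)) ℂ)
    (k : Fin K) : partialProduct N Q k.succ = Q k * partialProduct N Q k.castSucc :=
  Fin.induction_succ _ _ _

variable {Ω : Type*}
  {Q : (k : Fin K) → Ω → Matrix (Fin (N k.succ)) (Fin (N k.castSucc)) ℂ}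

/-- The entries of all the matrices, as one family of random variables. -/
def entry (Q : (k : Fin K) → Ω → Matrix (Fin (N k.succ)) (Fin (N k.castSucc)) ℂ)
    (e : (k : Fin K) × (Fin (N k.succ) × Fin (N k.castSucc))) (ω : Ω) : ℂ :=
  Q e.1 ω e.2.1 e.2.2

/-- A partial product involves only earlier factors, which makes it independent of the next one. -/
lemma measurable_partialProduct_past (k : Fin (K + 1)) (i : Fin (N k)) (j : Fin (N 0)) :
    Measurable[⨆ e ∈ {e : (k : Fin K) × (Fin (N k.succ) × Fin (N k.castSucc)) |
        e.1.castSucc < k}, MeasurableSpace.comap (entry Q e) inferInstance]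
      (fun ω => partialProduct N (fun k => Q k ω) k i j) := by
  induction k using Fin.induction generalizing j with
  | zero =>
    simp only [partialProduct_zero]
    exact measurable_const
  | succ k ih =>
    simp only [partialProduct_succ]
    refine measurable_mul_apply (mΩ := ⨆ e ∈ {e : (k : Fin K) × _ |
      e.1.castSucc < k.succ}, MeasurableSpace.comap (entry Q e) inferInstance)
      (fun i j => ?_) (fun i j => ?_) i j
    · exact measurable_iSup_comap_of_mem (entry Q) (i := ⟨k, i, j⟩) (Fin.castSucc_lt_succ)
    · refine (ih _ _).mono ?_ le_rfl
      exact biSup_mono fun e he => lt_trans he Fin.castSucc_lt_succ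

variable [MeasurableSpace Ω] {P : Measure Ω}

lemma measurable_partialProduct (hQm : ∀ e, Measurable (entry Q e)) (k : Fin (K + 1))
    (i : Fin (N k)) (j : Fin (N 0)) :
    Measurable fun ω => partialProduct N (fun k => Q k ω) k i j :=
  (measurable_partialProduct_past k i j).mono (iSup₂_le fun e _ => (hQm e).comap_le) le_rfl

lemma IsRayleigh.hasLaw_matrix (hQ : IsRayleigh P N Q) (k : Fin K) :
    HasLaw (fun ω (e : Fin (N k.succ) × Fin (N k.castSucc)) => Q k ω e.1 e.2)
      (gaussianPi (Fin (N k.succ) × Fin (N k.castSucc))) P :=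
  iIndepFun.hasLaw_pi (fun e => hQ.hasLaw k e.1 e.2)
    (hQ.indep.precomp (g := fun e : Fin (N k.succ) × Fin (N k.castSucc) => ⟨k, e⟩)
      fun a b hab => by simpa using hab)

lemma IsRayleigh.indepFun_partialProduct (hQ : IsRayleigh P N Q)
    (hQm : ∀ e, Measurable (entry Q e)) (k : Fin K) :
    IndepFun (fun ω (e : Fin (N k.succ) × Fin (N k.castSucc)) => Q k ω e.1 e.2)
      (fun ω (e : Fin (N k.castSucc) × Fin (N 0)) =>
        partialProduct N (fun k => Q k ω) k.castSucc e.1 e.2) P := by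
  refine indepFun_of_measurable_iSup_comap hQm hQ.indep
    (S := {e | e.1 = k}) (T := {e | e.1.castSucc < k.castSucc}) ?_ ?_ ?_
  · refine Set.disjoint_left.2 fun e h1 h2 => ?_
    rw [Set.mem_ofPred_eq] at h1 h2
    exact absurd h2 (by rw [h1]; exact lt_irrefl _)
  · exact @measurable_pi_lambda _ _ _ (_) _ _ fun e =>
      measurable_iSup_comap_of_mem (entry Q) (i := ⟨k, e⟩) rfl
  · exact @measurable_pi_lambda _ _ _ (_) _ _ fun e => measurable_partialProduct_past _ _ _

lemma filter_castSucc_lt_succ (k : Fin K) :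
    (Finset.univ.filter fun j : Fin K => j.castSucc < k.succ) =
      insert k (Finset.univ.filter fun j : Fin K => j.castSucc < k.castSucc) := by
  ext j
  simp only [Finset.mem_filter, Finset.mem_univ, true_and, Finset.mem_insert, Fin.lt_def,
    Fin.val_castSucc, Fin.val_succ, Fin.ext_iff]
  omega

/-- Each new factor multiplies the Gram determinant by that of a Gaussian `N_(k+1) × N_0` matrix;
the minimality of `N_0` keeps its log-mean finite. -/
lemma IsRayleigh.hasLogMean_partialProduct [IsProbabilityMeasure P] (hQ : IsRayleigh P N Q)
    (hQm : ∀ e, Measurable (entry Q e)) (hmin : ∀ k, N 0 ≤ N k) (k : Fin (K + 1)) :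
    HasLogMean P (fun ω => gramDet (partialProduct N (fun k => Q k ω) k))
      (∑ j : Fin K with j.castSucc < k, ∑ l ∈ Finset.range (N 0),
        ((harmonic (N j.succ - (l + 1)) : ℝ) - Real.eulerMascheroniConstant)) := by
  induction k using Fin.induction with
  | zero =>
    have h : gramDet (1 : Matrix (Fin (N 0)) (Fin (N 0)) ℂ) = 1 :=
      gramDet_of_conjTranspose_mul_self_eq_one (by simp)
    simp only [partialProduct_zero, h]
    exact ⟨by simp, by simp, by simp⟩
  | succ k ih =>
    rw [filter_castSucc_lt_succ, Finset.sum_insert (by simp),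
      add_comm (Finset.sum (Finset.range (N 0)) _)]
    simp only [partialProduct_succ]
    exact HasLogMean.of_indepFun (hQ.hasLaw_matrix k)
      (measurable_pi_lambda _ fun e => measurable_partialProduct hQm _ _ _)
      (hQ.indepFun_partialProduct hQm k)
      (F := fun z => gramDet (toMat z.1 * toMat z.2)) (D := fun y => gramDet (toMat y))
      (measurable_gramDet_of_entries fun i j => by
        simp only [mul_apply, toMat_apply]
        fun_prop)
      measurable_gramDet_toMat (fun y hy => map_gramDet_mul_div hy) ih
      ((HasLogMean.map_iff measurable_gramDet_toMat.aemeasurable measurable_id').2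
        (hasLogMean_gramDet_gaussianPi (hmin k.succ)))

lemma measurable_frobSq_of_entries {m n : Type*} [Fintype m] [Fintype n] {A : Ω → Matrix m n ℂ}
    (hA : ∀ i j, Measurable fun ω => A ω i j) : Measurable fun ω => frobSq (A ω) := by
  unfold frobSq
  exact Finset.measurable_sum _ fun i _ => Finset.measurable_sum _ fun j _ =>
    (hA i j).norm.pow_const 2

lemma IsRayleigh.lintegral_frobSq_partialProduct [IsProbabilityMeasure P]
    (hQ : IsRayleigh P N Q) (hQm : ∀ e, Measurable (entry Q e)) (k : Fin (K + 1)) :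
    ∫⁻ ω, ENNReal.ofReal (frobSq (partialProduct N (fun k => Q k ω) k)) ∂P =
      ENNReal.ofReal (N 0 * ∏ j : Fin K with j.castSucc < k, (N j.succ : ℝ)) := by
  induction k using Fin.induction with
  | zero =>
    have h : frobSq (1 : Matrix (Fin (N 0)) (Fin (N 0)) ℂ) = N 0 := by
      apply Complex.ofReal_injective
      rw [← trace_conjTranspose_mul_self_eq_frobSq]
      simp
    simp [partialProduct_zero, h]
  | succ k ih =>
    set Y : Ω → Fin (N k.castSucc) × Fin (N 0) → ℂ := fun ω e =>
      partialProduct N (fun k => Q k ω) k.castSucc e.1 e.2 with hYdef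
    have hY : Measurable Y :=
      measurable_pi_lambda _ fun e => measurable_partialProduct hQm _ _ _
    have hlaw := (indepFun_iff_hasLaw_prodMk_prod (hQ.hasLaw_matrix k)
      (⟨hY.aemeasurable, rfl⟩ : HasLaw Y (P.map Y) P)).1 (hQ.indepFun_partialProduct hQm k)
    have : IsProbabilityMeasure (P.map Y) := Measure.isProbabilityMeasure_map hY.aemeasurable
    have hF : Measurable fun z : (Fin (N k.succ) × Fin (N k.castSucc) → ℂ) ×
        (Fin (N k.castSucc) × Fin (N 0) → ℂ) =>
        ENNReal.ofReal (frobSq (toMat z.1 * toMat z.2)) :=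
      (measurable_frobSq_of_entries fun i j => by
        simp only [mul_apply, toMat_apply]
        fun_prop).ennreal_ofReal
    have hG : Measurable fun y : Fin (N k.castSucc) × Fin (N 0) → ℂ =>
        ENNReal.ofReal (frobSq (toMat y)) :=
      (measurable_frobSq_of_entries fun i j => measurable_pi_apply (i, j)).ennreal_ofReal
    have h := hlaw.lintegral_comp hF.aemeasurable
    rw [lintegral_prod_symm _ hF.aemeasurable] at h
    simp only [lintegral_frobSq_mul] at h
    rw [lintegral_const_mul _ hG, lintegral_map hG hY, Fintype.card_fin] at h
    simp only [partialProduct_succ]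
    refine h.trans ?_
    refine (congrArg _ ih).trans ?_
    rw [filter_castSucc_lt_succ, Finset.prod_insert (by simp), ← ENNReal.ofReal_natCast,
      ← ENNReal.ofReal_mul (by positivity)]
    congr 1
    ring

lemma measurable_capacity_of_entries {m n : ℕ} (q : ℝ) {A : Ω → Matrix (Fin m) (Fin n) ℂ}
    (hA : ∀ i j, Measurable fun ω => A ω i j) : Measurable fun ω => capacity q (A ω) := by
  have hgram : ∀ i j, Measurable fun ω => ∑ k, star (A ω k i) * A ω k j := fun i j =>
    Finset.measurable_sum _ fun k _ =>
      (Complex.continuous_conj.measurable.comp (hA _ _)).mul (hA _ _)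
  simp only [capacity, det_apply, Matrix.add_apply, Matrix.smul_apply, mul_apply,
    conjTranspose_apply, smul_eq_mul]
  refine Real.measurable_log.comp (Complex.measurable_re.comp ?_)
  refine Finset.measurable_sum _ fun σ _ => Measurable.const_smul ?_ _
  exact Finset.measurable_prod _ fun i _ => measurable_const.add ((hgram _ _).const_mul _)

lemma integral_const_add_const_mul [IsProbabilityMeasure P] (a b : ℝ) {f : Ω → ℝ}
    (hf : Integrable f P) : ∫ ω, a + b * f ω ∂P = a + b * ∫ ω, f ω ∂P := by
  rw [integral_add (integrable_const _) (hf.const_mul b), integral_const_mul]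
  simp

/-- The bounds on the ergodic capacity, for channels with measurable entries. -/
lemma IsRayleigh.ergodicCapacity_bounds_of_measurable [IsProbabilityMeasure P]
    (hQ : IsRayleigh P N Q) (hQm : ∀ e, Measurable (entry Q e)) (hN0 : 1 ≤ N 0)
    (hmin : ∀ k, N 0 ≤ N k) {q : ℝ} (hq : 0 ≤ q) :
    Integrable (fun ω => capacity q (productChannel N fun k => Q k ω)) P ∧
    (N 0 : ℝ) * Real.log (1 + q * Real.exp (gConst N - K * Real.eulerMascheroniConstant))
      ≤ ergodicCapacity P N Q q ∧
    ergodicCapacity P N Q q ≤ (N 0 : ℝ) * Real.log (1 + q * ∏ k : Fin K, (N k.succ : ℝ)) := by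
  have hM := measurable_partialProduct hQm (Fin.last K)
  have hall : (Finset.univ.filter fun j : Fin K => j.castSucc < Fin.last K) = Finset.univ :=
    Finset.filter_true_of_mem fun j _ => Fin.castSucc_lt_last j
  have hlog := hQ.hasLogMean_partialProduct hQm hmin (Fin.last K)
  have hfrob := hQ.lintegral_frobSq_partialProduct hQm (Fin.last K)
  rw [hall] at hlog hfrob
  rw [sum_log_means_eq hN0] at hlog
  change Integrable (fun ω => capacity q (partialProduct N (fun k => Q k ω) (Fin.last K))) P ∧
    _ ≤ ∫ ω, capacity q (partialProduct N (fun k => Q k ω) (Fin.last K)) ∂P ∧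
    ∫ ω, capacity q (partialProduct N (fun k => Q k ω) (Fin.last K)) ∂P ≤ _
  set M := fun ω => partialProduct N (fun k => Q k ω) (Fin.last K)
  set c := gConst N - K * Real.eulerMascheroniConstant
  set π := ∏ k : Fin K, (N k.succ : ℝ) with hπ
  have hπ0 : 0 ≤ π := by positivity
  have hfi : Integrable (fun ω => frobSq (M ω)) P :=
    ⟨(measurable_frobSq_of_entries hM).aestronglyMeasurable, by
      rw [hasFiniteIntegral_iff_ofReal (.of_forall fun ω => frobSq_nonneg _), hfrob]
      exact ENNReal.ofReal_lt_top⟩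
  have hfint : ∫ ω, frobSq (M ω) ∂P = N 0 * π := by
    rw [integral_eq_lintegral_of_nonneg_ae (.of_forall fun ω => frobSq_nonneg _)
      hfi.aestronglyMeasurable, hfrob, ENNReal.toReal_ofReal (by positivity)]
  have hub : ∀ a : ℝ, Integrable (fun ω =>
      (N 0 : ℝ) * Real.log a + (N 0 + q * frobSq (M ω) - N 0 * a) / a) P := fun a =>
    (integrable_const _).add
      ((((integrable_const _).add (hfi.const_mul q)).sub (integrable_const _)).div_const a)
  have hint : Integrable (fun ω => capacity q (M ω)) P := by
    -- Any tangent point serves for domination; `a = 1` gives the bound `q ‖H‖_F²`.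
    refine (hub 1).mono' (measurable_capacity_of_entries q hM).aestronglyMeasurable
      (.of_forall fun ω => ?_)
    rw [Real.norm_of_nonneg (capacity_nonneg _ hq)]
    exact capacity_le _ hq one_pos
  refine ⟨hint, ?_, ?_⟩
  · have hli : Integrable (fun ω => (N 0 : ℝ) * Real.log (1 + q * Real.exp c) +
        q * Real.exp c / (1 + q * Real.exp c) * (Real.log (gramDet (M ω)) - N 0 * c)) P :=
      (integrable_const _).add ((hlog.integrable.sub (integrable_const _)).const_mul _)
    have h := integral_mono_ae hli hint <| by
      filter_upwards [hlog.pos] with ω hω using le_capacity _ hq hω c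
    refine le_trans (le_of_eq ?_) h
    set s := q * Real.exp c / (1 + q * Real.exp c)
    have he : ∀ ω, (N 0 : ℝ) * Real.log (1 + q * Real.exp c) +
        s * (Real.log (gramDet (M ω)) - N 0 * c) =
        (N 0 * Real.log (1 + q * Real.exp c) - s * (N 0 * c)) + s * Real.log (gramDet (M ω)) :=
      fun ω => by ring
    simp only [he]
    rw [integral_const_add_const_mul _ _ hlog.integrable, hlog.integral_eq]
    ring
  · have ha : 0 < 1 + q * π := by positivity
    -- `1 + q π` is the mean of the averaged eigenvalue of `I + q H† H`, so the linear term
    -- integrates to zero.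
    refine (integral_mono hint (hub (1 + q * π)) fun ω => capacity_le _ hq ha).trans
      (le_of_eq ?_)
    have he : ∀ ω, (N 0 : ℝ) * Real.log (1 + q * π) +
        (N 0 + q * frobSq (M ω) - N 0 * (1 + q * π)) / (1 + q * π) =
        (N 0 * Real.log (1 + q * π) - N 0 * (q * π) / (1 + q * π)) +
          q / (1 + q * π) * frobSq (M ω) := fun ω => by ring
    simp only [he]
    rw [integral_const_add_const_mul _ _ hfi, hfint]
    ring

end Channel

end RayleighProduct

end

theorem mainTheorem2 {Ω : Type*} [MeasurableSpace Ω] (P : MeasureTheory.Measure Ω)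
    [MeasureTheory.IsProbabilityMeasure P] {K : ℕ} (N : Fin (K + 1) → ℕ)
    (hN0 : 1 ≤ N 0) (hmin : ∀ k, N 0 ≤ N k)
    (Q : (k : Fin K) → Ω → Matrix (Fin (N k.succ)) (Fin (N k.castSucc)) ℂ)
    (hQ : RayleighProduct.IsRayleigh P N Q) (q : ℝ) (hq : 0 ≤ q) :
    MeasureTheory.Integrable
      (fun ω => RayleighProduct.capacity q (RayleighProduct.productChannel N fun k => Q k ω)) P ∧
    (N 0 : ℝ) * Real.log
        (1 + q * Real.exp (RayleighProduct.gConst N - K * Real.eulerMascheroniConstant))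
      ≤ RayleighProduct.ergodicCapacity P N Q q ∧
    RayleighProduct.ergodicCapacity P N Q q
      ≤ (N 0 : ℝ) * Real.log (1 + q * ∏ k : Fin K, (N k.succ : ℝ)) ∧
    RayleighProduct.gConst N = K * Real.eulerMascheroniConstant +
      (1 / (N 0 : ℝ)) * ∑ k : Fin K, ∑ l ∈ Finset.Icc 1 (N 0),
        RayleighProduct.digamma ((N k.succ : ℝ) - l + 1) := by
  have hm : ∀ k i j, AEMeasurable (fun ω => Q k ω i j) P :=
    fun k i j => (hQ.hasLaw k i j).aemeasurable
  -- The laws give only a.e. measurable entries, but the σ-algebra argument for independence needs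
  -- measurable ones; the modification changes no integral.
  let Q' : (k : Fin K) → Ω → Matrix (Fin (N k.succ)) (Fin (N k.castSucc)) ℂ :=
    fun k ω => Matrix.of fun i j => (hm k i j).mk _ ω
  have hQ' : RayleighProduct.IsRayleigh P N Q' :=
    ⟨fun k i j => (hQ.hasLaw k i j).congr (hm k i j).ae_eq_mk.symm,
      hQ.indep.congr fun e => (hm e.1 e.2.1 e.2.2).ae_eq_mk⟩
  have hQQ : ∀ᵐ ω ∂P, ∀ k, Q' k ω = Q k ω := by
    have : ∀ᵐ ω ∂P, ∀ k i j, Q k ω i j = Q' k ω i j :=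
      ae_all_iff.2 fun k => ae_all_iff.2 fun i => ae_all_iff.2 fun j => (hm k i j).ae_eq_mk
    filter_upwards [this] with ω hω k
    ext i j
    exact (hω k i j).symm
  have hcap : (fun ω => RayleighProduct.capacity q
      (RayleighProduct.productChannel N fun k => Q' k ω)) =ᵐ[P] fun ω =>
      RayleighProduct.capacity q (RayleighProduct.productChannel N fun k => Q k ω) := by
    filter_upwards [hQQ] with ω hω
    simp only [hω]
  obtain ⟨h1, h2, h3⟩ := hQ'.ergodicCapacity_bounds_of_measurable
    (fun e => (hm e.1 e.2.1 e.2.2).measurable_mk) hN0 hmin hq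
  have he : RayleighProduct.ergodicCapacity P N Q' q = RayleighProduct.ergodicCapacity P N Q q :=
    integral_congr_ae hcap
  rw [he] at h2 h3
  exact ⟨h1.congr hcap, h2, h3, RayleighProduct.gConst_eq_digamma hN0 hmin⟩
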